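/- There are $n$ persons, each of whom initially knows exactly one gossip of his own (different persons know different gossips). In a telephone call two different persons tell each other all the gossips they know at that moment; calls are made one after another. For $2\le k\le n$ let $P(n,k)$ be the minimum number of calls in a finite sequence of calls after which each of the $n$ persons knows at least $k$ gossips (his own included). For an integer $k\ge 4$ and integers $-1\le i\le k-4$ put $t_i(k)=i+2^{k-i-2}$. Let $n$, $k$, $i$ be integers with $0\le i\le k-4$ and $t_i(k)\le n<t_{i-1}(k)$. Then $P(n,k)=n+i$. -/

import Mathlib

namespace PartialGossip

/-- The telephone call `c` between the persons `c.1` and `c.2`: `K v` is the set of gossips that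
person `v` knows before the call; after it, both participants know everything that either of them
knew, and nobody else learns anything. -/
def call {V : Type*} [DecidableEq V] (K : V → Finset V) (c : V × V) : V → Finset V :=
  fun v => if v = c.1 ∨ v = c.2 then K c.1 ∪ K c.2 else K v

/-- The gossips known to each person when all the calls of the list `s` have been made, in the order
of the list. At the beginning each person knows exactly his own gossip. -/
def knowledge {V : Type*} [DecidableEq V] (s : List (V × V)) : V → Finset V :=
  s.foldl call (fun v => {v})

/-- A communication scheme is a finite sequence of calls, each between two different persons. -/
def IsScheme {V : Type*} (s : List (V × V)) : Prop :=
  ∀ c ∈ s, c.1 ≠ c.2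

/-- Every person knows at least `k` gossips when all the calls are completed. -/
def IsInforming {V : Type*} [DecidableEq V] (k : ℕ) (s : List (V × V)) : Prop :=
  ∀ v : V, k ≤ (knowledge s v).card

/-- The minimum number of calls needed for each of `n` persons to know at least `k` gossips.
(For `k ≤ n` such schemes exist; the infimum of the empty set is `0` by convention.) -/
noncomputable def P (n k : ℕ) : ℕ :=
  sInf {m : ℕ | ∃ s : List (Fin n × Fin n), IsScheme s ∧ IsInforming k s ∧ s.length = m}

/-- `t k i = i + 2 ^ (k - i - 2)`, for `-1 ≤ i ≤ k - 4`; the exponent, computed in the integers,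
is at least `2` in that range. -/
def t (k : ℕ) (i : ℤ) : ℤ :=
  i + 2 ^ ((k : ℤ) - i - 2).toNat

end PartialGossip

namespace PartialGossip

/-! Lower bound. Tracing the calls backwards from the end gives, for a set of persons, the earlier
calls and persons that influence what it finally knows. The claim (`lower_bound_aux`) is that if
every member of a nonempty `L` knows `k` gossips and fewer than `L.card + j` calls influence `L`,
then at least `j - 1 + 2 ^ (k - j - 1)` gossips reach `L`; all persons together form the case of
interest.

Take `L` minimal. Read backwards, the calls that touch `L` join disjoint tree-like clusters inside
`L`, until just two clusters `A`, `B` make up `L` (`Critical.exists_two_clusters`). Counting shows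
that the same `j + 1` still earlier calls influence `A`, `B` and `L`. By `Critical.treeBound`, a
proper cluster influenced by `w` earlier calls has about `2 ^ (k - 1 - w)` fresh members, that is,
members without earlier calls: merging two clusters along a call adds their fresh members, while
that call leaves the earlier ones, so `w` may drop by one. The bound may fail by at most two, and by
less if the earlier calls have few participants. If they are few, the bound for `A` and induction on
`B` with `j + 1` suffice; if they are many, their number makes up for the loss in both bounds.

Upper bound. Four persons learn everything in four calls. Giving everyone a private partner to call
at the end doubles the number of persons and of calls and raises `k` by one. A person making the
first and the last call costs two calls and raises `k` by one; a person who only calls at the end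
costs one call. -/

variable {V : Type*} [DecidableEq V]

/-! ### Backward tracing of influence -/

/-- The persons whose gossip reaches the set `X` through the calls of `l`, which are listed with the
latest call first. -/
def reach : List (V × V) → Finset V → Finset V
  | [], X => X
  | c :: l, X => if c.1 ∈ X ∨ c.2 ∈ X then reach l (insert c.1 (insert c.2 X)) else reach l X

/-- The number of calls of `l` (latest call first) that influence what the members of `X` know. -/
def relCount : List (V × V) → Finset V → ℕ
  | [], _ => 0
  | c :: l, X =>
    if c.1 ∈ X ∨ c.2 ∈ X then relCount l (insert c.1 (insert c.2 X)) + 1 else relCount l X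

/-- The participants of the calls of `l` (latest call first) that influence what the members of `X`
know. -/
def relPersons : List (V × V) → Finset V → Finset V
  | [], _ => ∅
  | c :: l, X =>
    if c.1 ∈ X ∨ c.2 ∈ X then insert c.1 (insert c.2 (relPersons l (insert c.1 (insert c.2 X))))
    else relPersons l X

theorem reach_eq_union (l : List (V × V)) (X : Finset V) : reach l X = X ∪ relPersons l X := by
  induction l generalizing X with
  | nil => simp [reach, relPersons]
  | cons c l ih =>
    simp only [reach, relPersons]
    split_ifs with h
    · rw [ih]; ext v; simp only [Finset.mem_union, Finset.mem_insert]; tauto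
    · exact ih X

theorem reach_mono (l : List (V × V)) {X Y : Finset V} (h : X ⊆ Y) : reach l X ⊆ reach l Y := by
  induction l generalizing X Y with
  | nil => exact h
  | cons c l ih =>
    simp only [reach]
    split_ifs with h1 h2 h2
    · exact ih (Finset.insert_subset_insert _ (Finset.insert_subset_insert _ h))
    · exact absurd (h1.imp (fun a => h a) (fun a => h a)) h2
    · exact ih (h.trans fun v hv => by simp [hv])
    · exact ih h

theorem reach_union (l : List (V × V)) (X Y : Finset V) :
    reach l (X ∪ Y) = reach l X ∪ reach l Y := by
  induction l generalizing X Y with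
  | nil => rfl
  | cons c l ih =>
    have key : insert c.1 (insert c.2 (X ∪ Y)) =
        insert c.1 (insert c.2 X) ∪ insert c.1 (insert c.2 Y) := by
      ext v; simp only [Finset.mem_union, Finset.mem_insert]; tauto
    simp only [reach, Finset.mem_union]
    by_cases hX : c.1 ∈ X ∨ c.2 ∈ X <;> by_cases hY : c.1 ∈ Y ∨ c.2 ∈ Y
    · rw [if_pos (by tauto), if_pos hX, if_pos hY, key, ih]
    · rw [if_pos (by tauto), if_pos hX, if_neg hY, ← ih]
      congr 1; ext v; simp only [Finset.mem_union, Finset.mem_insert]; tauto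
    · rw [if_pos (by tauto), if_neg hX, if_pos hY, ← ih]
      congr 1; ext v; simp only [Finset.mem_union, Finset.mem_insert]; tauto
    · rw [if_neg (by tauto), if_neg hX, if_neg hY, ih]

theorem relCount_mono (l : List (V × V)) {X Y : Finset V} (h : X ⊆ Y) :
    relCount l X ≤ relCount l Y := by
  induction l generalizing X Y with
  | nil => exact le_rfl
  | cons c l ih =>
    simp only [relCount]
    split_ifs with h1 h2 h2
    · exact Nat.succ_le_succ
        (ih (Finset.insert_subset_insert _ (Finset.insert_subset_insert _ h)))
    · exact absurd (h1.imp (fun a => h a) (fun a => h a)) h2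
    · exact (ih (h.trans fun v hv => by simp [hv])).trans (Nat.le_succ _)
    · exact ih h

theorem relCount_le_length (l : List (V × V)) (X : Finset V) : relCount l X ≤ l.length := by
  induction l generalizing X with
  | nil => exact le_rfl
  | cons c l ih =>
    simp only [relCount, List.length_cons]
    split_ifs
    · exact Nat.succ_le_succ (ih _)
    · exact (ih _).trans (Nat.le_succ _)

/-- A call that has influence already has a participant in the traced set, so it adds at most one
person. -/
theorem card_reach_le (l : List (V × V)) (X : Finset V) :
    (reach l X).card ≤ X.card + relCount l X := by
  induction l generalizing X with
  | nil => simp [reach, relCount]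
  | cons c l ih =>
    simp only [reach, relCount]
    split_ifs with h
    · have h1 := ih (insert c.1 (insert c.2 X))
      have h2 : (insert c.1 (insert c.2 X)).card ≤ X.card + 1 := by
        rcases h with h | h
        · rw [Finset.insert_eq_of_mem (Finset.mem_insert_of_mem h)]
          exact Finset.card_insert_le _ _
        · rw [Finset.insert_eq_of_mem h]
          exact Finset.card_insert_le _ _
      omega
    · exact ih X

theorem reach_append (F l : List (V × V)) (X : Finset V) :
    reach (F ++ l) X = reach l (reach F X) := by
  induction F generalizing X with
  | nil => rfl
  | cons c F ih => simp only [List.cons_append, reach]; split_ifs <;> exact ih _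

theorem relCount_append (F l : List (V × V)) (X : Finset V) :
    relCount (F ++ l) X = relCount F X + relCount l (reach F X) := by
  induction F generalizing X with
  | nil => simp [relCount, reach]
  | cons c F ih =>
    simp only [List.cons_append, relCount, reach]
    split_ifs <;> rw [ih]
    omega

/-- Every call that influences `X` also influences `Y`, so equality of the counts means that the
calls are the same. -/
theorem relPersons_congr (l : List (V × V)) {X Y : Finset V} (h : X ⊆ Y)
    (hN : relCount l Y ≤ relCount l X) : relPersons l X = relPersons l Y := by
  induction l generalizing X Y with
  | nil => rfl
  | cons c l ih =>
    simp only [relCount] at hN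
    simp only [relPersons]
    have hY' : X ⊆ insert c.1 (insert c.2 Y) := h.trans fun v hv => by simp [hv]
    by_cases hX : c.1 ∈ X ∨ c.2 ∈ X
    · have hY : c.1 ∈ Y ∨ c.2 ∈ Y := hX.imp (fun a => h a) (fun a => h a)
      rw [if_pos hX, if_pos hY] at hN
      rw [if_pos hX, if_pos hY,
        ih (Finset.insert_subset_insert _ (Finset.insert_subset_insert _ h)) (by omega)]
    · by_cases hY : c.1 ∈ Y ∨ c.2 ∈ Y
      · rw [if_neg hX, if_pos hY] at hN
        have := relCount_mono l hY'
        omega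
      · rw [if_neg hX, if_neg hY] at hN
        rw [if_neg hX, if_neg hY, ih h hN]

/-- `v` takes part in some call of `l`. -/
def Involved {V : Type*} (l : List (V × V)) (v : V) : Prop := ∃ c ∈ l, v = c.1 ∨ v = c.2

theorem involved_of_mem_relPersons {l : List (V × V)} {X : Finset V} {v : V}
    (h : v ∈ relPersons l X) : Involved l v := by
  induction l generalizing X with
  | nil => simp [relPersons] at h
  | cons c l ih =>
    simp only [relPersons] at h
    have lift : Involved l v → Involved (c :: l) v := fun ⟨d, hd, h⟩ => ⟨d, by simp [hd], h⟩
    split_ifs at h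
    · rw [Finset.mem_insert, Finset.mem_insert] at h
      rcases h with h | h | h
      · exact ⟨c, by simp, Or.inl h⟩
      · exact ⟨c, by simp, Or.inr h⟩
      · exact lift (ih h)
    · exact lift (ih h)

theorem mem_relPersons_of_involved {l : List (V × V)} {X : Finset V} {v : V} (hv : v ∈ X)
    (h : Involved l v) : v ∈ relPersons l X := by
  induction l generalizing X with
  | nil => obtain ⟨c, hc, -⟩ := h; simp at hc
  | cons c l ih =>
    obtain ⟨d, hd, hdv⟩ := h
    simp only [relPersons]
    by_cases hc : v = c.1 ∨ v = c.2
    · rw [if_pos (by rcases hc with rfl | rfl <;> simp [hv])]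
      rcases hc with rfl | rfl <;> simp
    · have hd' : d ∈ l := by
        rcases List.mem_cons.1 hd with rfl | h
        · exact absurd hdv hc
        · exact h
      split_ifs
      · exact Finset.mem_insert_of_mem (Finset.mem_insert_of_mem (ih (by simp [hv]) ⟨d, hd', hdv⟩))
      · exact ih hv ⟨d, hd', hdv⟩

theorem mem_relPersons_iff {l : List (V × V)} {X : Finset V} {v : V} (hv : v ∈ X) :
    v ∈ relPersons l X ↔ Involved l v :=
  ⟨involved_of_mem_relPersons, mem_relPersons_of_involved hv⟩

theorem involved_cons {V : Type*} {c : V × V} {l : List (V × V)} {v : V} :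
    Involved (c :: l) v ↔ (v = c.1 ∨ v = c.2) ∨ Involved l v := by
  simp [Involved]

theorem knowledge_eq_reach (s : List (V × V)) (v : V) : knowledge s v = reach s.reverse {v} := by
  induction s using List.reverseRecOn generalizing v with
  | nil => rfl
  | append_singleton s c ih =>
    have h1 : knowledge (s ++ [c]) v = call (knowledge s) c v := by
      simp [knowledge, List.foldl_append]
    rw [h1, List.reverse_append, List.reverse_singleton, List.singleton_append]
    simp only [call, reach, Finset.mem_singleton]
    by_cases h : v = c.1 ∨ v = c.2
    · rw [if_pos h, if_pos (by tauto), ih, ih, ← reach_union]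
      congr 1
      ext w
      simp only [Finset.mem_union, Finset.mem_singleton, Finset.mem_insert]
      rcases h with rfl | rfl <;> tauto
    · rw [if_neg h, if_neg (by rintro (h' | h') <;> simp [h'] at h), ih]

/-! ### Clusters: trees of late calls -/

/-- A set that no call of `F` connects with its complement. -/
def ClosedUnder (F : List (V × V)) (C : Finset V) : Prop := ∀ c ∈ F, c.1 ∈ C ↔ c.2 ∈ C

theorem ClosedUnder.reach_eq {F : List (V × V)} {C : Finset V} (h : ClosedUnder F C) :
    reach F C = C := by
  induction F with
  | nil => rfl
  | cons c F ih =>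
    have h1 := h c (by simp)
    have h2 := ih fun d hd => h d (by simp [hd])
    simp only [reach]
    split_ifs with hc
    · have h3 : c.1 ∈ C := by tauto
      have h4 : c.2 ∈ C := by tauto
      rw [Finset.insert_eq_of_mem h4, Finset.insert_eq_of_mem h3, h2]
    · exact h2

theorem ClosedUnder.disjoint_reach {F : List (V × V)} {C X : Finset V} (h : ClosedUnder F C)
    (hX : Disjoint X C) : Disjoint (reach F X) C := by
  induction F generalizing X with
  | nil => exact hX
  | cons c F ih =>
    have h1 := h c (by simp)
    have h2 : ClosedUnder F C := fun d hd => h d (by simp [hd])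
    simp only [reach]
    split_ifs with hc
    · refine ih h2 ?_
      have hd : ∀ v ∈ X, v ∉ C := fun v hv => Finset.disjoint_left.1 hX hv
      rw [Finset.disjoint_insert_left, Finset.disjoint_insert_left]
      rcases hc with hc | hc
      · have := hd _ hc; exact ⟨this, by tauto, hX⟩
      · have := hd _ hc; exact ⟨by tauto, this, hX⟩
    · exact ih h2 hX

/-- No call crosses the boundary of `C`, so the traces of `X` and `C` never meet and no call is
counted twice. -/
theorem ClosedUnder.relCount_union {F : List (V × V)} {C X : Finset V} (h : ClosedUnder F C)
    (hX : Disjoint X C) : relCount F (X ∪ C) = relCount F X + relCount F C := by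
  induction F generalizing X with
  | nil => rfl
  | cons c F ih =>
    have h1 := h c (by simp)
    have h2 : ClosedUnder F C := fun d hd => h d (by simp [hd])
    have hd : ∀ v ∈ X, v ∉ C := fun v hv => Finset.disjoint_left.1 hX hv
    simp only [relCount, Finset.mem_union]
    by_cases hc : c.1 ∈ C
    · have hc2 : c.2 ∈ C := h1.1 hc
      have e1 : insert c.1 (insert c.2 (X ∪ C)) = X ∪ C := by
        rw [Finset.insert_eq_of_mem (by simp [hc]), Finset.insert_eq_of_mem (by simp [hc2])]
      have e2 : insert c.1 (insert c.2 C) = C := by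
        rw [Finset.insert_eq_of_mem (by simp [hc]), Finset.insert_eq_of_mem (by simp [hc2])]
      have n1 : c.1 ∉ X := fun h => hd _ h hc
      have n2 : c.2 ∉ X := fun h => hd _ h hc2
      rw [if_pos (by tauto), if_neg (by tauto), if_pos (by tauto), e1, e2, ih h2 hX]
      omega
    · have hc2 : c.2 ∉ C := fun h => hc (h1.2 h)
      rw [if_neg (show ¬ (c.1 ∈ C ∨ c.2 ∈ C) by tauto)]
      by_cases hcX : c.1 ∈ X ∨ c.2 ∈ X
      · have e1 : insert c.1 (insert c.2 (X ∪ C)) = insert c.1 (insert c.2 X) ∪ C := by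
          rw [Finset.insert_union, Finset.insert_union]
        rw [if_pos (by tauto), if_pos hcX, e1, ih h2 (by
          rw [Finset.disjoint_insert_left, Finset.disjoint_insert_left]; exact ⟨hc, hc2, hX⟩)]
        omega
      · rw [if_neg (by tauto), if_neg hcX, ih h2 hX]

/-- `Cluster F C`: the calls of `F` (latest call first) that have a participant in `C` form a
spanning tree of `C`. -/
inductive Cluster : List (V × V) → Finset V → Prop
  | single (v : V) : Cluster [] {v}
  | skip {F : List (V × V)} {C : Finset V} {c : V × V} (h : Cluster F C) (h1 : c.1 ∉ C)
      (h2 : c.2 ∉ C) : Cluster (F ++ [c]) C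
  | merge {F : List (V × V)} {A B : Finset V} {c : V × V} (hA : Cluster F A) (hB : Cluster F B)
      (hAB : Disjoint A B) (h1 : c.1 ∈ A) (h2 : c.2 ∈ B) : Cluster (F ++ [c]) (A ∪ B)

theorem Cluster.closedUnder {F : List (V × V)} {C : Finset V} (h : Cluster F C) :
    ClosedUnder F C := by
  induction h with
  | single v => intro c hc; simp at hc
  | skip _ h1 h2 ih =>
    intro d hd
    rcases List.mem_append.1 hd with hd | hd
    · exact ih d hd
    · rw [List.mem_singleton.1 hd]; tauto
  | merge _ _ _ h1 h2 ihA ihB =>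
    intro d hd
    rcases List.mem_append.1 hd with hd | hd
    · rw [Finset.mem_union, Finset.mem_union, ihA d hd, ihB d hd]
    · rw [List.mem_singleton.1 hd]; simp [h1, h2]

theorem Cluster.relCount_add_one {F : List (V × V)} {C : Finset V} (h : Cluster F C) :
    relCount F C + 1 = C.card := by
  induction h with
  | single v => simp [relCount]
  | skip h h1 h2 ih =>
    rw [relCount_append, h.closedUnder.reach_eq]
    simp [relCount, h1, h2, ih]
  | merge hA hB hAB h1 h2 ihA ihB =>
    rw [relCount_append, hB.closedUnder.relCount_union hAB, reach_union, hA.closedUnder.reach_eq,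
      hB.closedUnder.reach_eq, Finset.card_union_of_disjoint hAB]
    simp [relCount, h1]
    omega

theorem Cluster.nonempty {F : List (V × V)} {C : Finset V} (h : Cluster F C) : C.Nonempty :=
  Finset.card_pos.1 (by have := h.relCount_add_one; omega)

/-! ### Calls that influence several overlapping sets -/

theorem relCount_cons_of_mem {c : V × V} {l : List (V × V)} {X : Finset V}
    (h : c.1 ∈ X ∨ c.2 ∈ X) :
    relCount (c :: l) X = relCount l (insert c.1 (insert c.2 X)) + 1 := by
  simp only [relCount, if_pos h]

theorem relCount_cons_of_not_mem {c : V × V} {l : List (V × V)} {X : Finset V}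
    (h : ¬ (c.1 ∈ X ∨ c.2 ∈ X)) : relCount (c :: l) X = relCount l X := by
  simp only [relCount, if_neg h]

theorem mem_of_relCount_le {c : V × V} {l : List (V × V)} {X Y : Finset V} (hXY : X ⊆ Y)
    (hY : c.1 ∈ Y ∨ c.2 ∈ Y) (h : relCount (c :: l) Y ≤ relCount (c :: l) X) :
    c.1 ∈ X ∨ c.2 ∈ X := by
  by_contra hX
  rw [relCount_cons_of_mem hY, relCount_cons_of_not_mem hX] at h
  have := relCount_mono l (hXY.trans fun v hv => by simp [hv] : X ⊆ insert c.1 (insert c.2 Y))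
  omega

/-- If the calls that influence `A ∪ B` all influence `A`, `B` and `O`, where `A` and `B` have only
`D` in common and `O` meets `A ∪ B` only in `D`, then they all influence `D`. -/
theorem relCount_le_of_inter (l : List (V × V)) {A B D O : Finset V} (hDA : D ⊆ A) (hDB : D ⊆ B)
    (hAB : ∀ v, v ∈ A → v ∈ B → v ∈ D) (hO : ∀ v, v ∈ O → v ∈ A ∪ B → v ∈ D)
    (hA : relCount l (A ∪ B) ≤ relCount l A) (hB : relCount l (A ∪ B) ≤ relCount l B)
    (hABO : relCount l (A ∪ B ∪ O) ≤ relCount l O) : relCount l (A ∪ B) ≤ relCount l D := by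
  induction l generalizing A B D O with
  | nil => exact le_rfl
  | cons c l ih =>
    have key : ∀ X Y : Finset V, insert c.1 (insert c.2 (X ∪ Y)) =
        insert c.1 (insert c.2 X) ∪ insert c.1 (insert c.2 Y) := by
      intro X Y; ext v; simp only [Finset.mem_union, Finset.mem_insert]; tauto
    by_cases hc : c.1 ∈ A ∪ B ∨ c.2 ∈ A ∪ B
    · have cA := mem_of_relCount_le Finset.subset_union_left hc hA
      have cB := mem_of_relCount_le Finset.subset_union_right hc hB
      have hc' : c.1 ∈ A ∪ B ∪ O ∨ c.2 ∈ A ∪ B ∪ O := by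
        exact hc.imp (fun h => Finset.mem_union_left _ h) (fun h => Finset.mem_union_left _ h)
      have cO := mem_of_relCount_le Finset.subset_union_right hc' hABO
      -- A participant in `O` either lies in `A ∪ B`, hence in `D`, or lies in neither `A` nor `B`;
      -- then the other participant must lie in both, hence in `D`.
      have cD : c.1 ∈ D ∨ c.2 ∈ D := by
        rcases cO with o | o
        · by_cases h1 : c.1 ∈ A ∪ B
          · exact Or.inl (hO _ o h1)
          · rw [Finset.mem_union, not_or] at h1
            exact Or.inr (hAB _ (cA.resolve_left h1.1) (cB.resolve_left h1.2))
        · by_cases h1 : c.2 ∈ A ∪ B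
          · exact Or.inr (hO _ o h1)
          · rw [Finset.mem_union, not_or] at h1
            exact Or.inl (hAB _ (cA.resolve_right h1.1) (cB.resolve_right h1.2))
      rw [relCount_cons_of_mem hc, key, relCount_cons_of_mem cA] at hA
      rw [relCount_cons_of_mem hc, key, relCount_cons_of_mem cB] at hB
      rw [relCount_cons_of_mem hc', key, key, relCount_cons_of_mem cO] at hABO
      rw [relCount_cons_of_mem hc, key, relCount_cons_of_mem cD]
      refine Nat.succ_le_succ (ih (O := insert c.1 (insert c.2 O)) ?_ ?_ ?_ ?_ ?_ ?_ ?_)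
      · exact Finset.insert_subset_insert _ (Finset.insert_subset_insert _ hDA)
      · exact Finset.insert_subset_insert _ (Finset.insert_subset_insert _ hDB)
      · clear * - hAB; intro v; have := hAB v; simp only [Finset.mem_insert]; tauto
      · clear * - hO
        intro v
        have := hO v
        simp only [Finset.mem_insert, Finset.mem_union] at this ⊢
        tauto
      · omega
      · omega
      · omega
    · have cA : ¬ (c.1 ∈ A ∨ c.2 ∈ A) := by
        simp only [Finset.mem_union] at hc; clear * - hc; tauto
      have cB : ¬ (c.1 ∈ B ∨ c.2 ∈ B) := by
        simp only [Finset.mem_union] at hc; clear * - hc; tauto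
      have cD : ¬ (c.1 ∈ D ∨ c.2 ∈ D) := fun h => cA (h.imp (fun a => hDA a) (fun a => hDA a))
      rw [relCount_cons_of_not_mem hc, relCount_cons_of_not_mem cA] at hA
      rw [relCount_cons_of_not_mem hc, relCount_cons_of_not_mem cB] at hB
      rw [relCount_cons_of_not_mem hc, relCount_cons_of_not_mem cD]
      -- A call that misses `A ∪ B` can only enlarge `O` by persons outside `A ∪ B`, which preserves
      -- the hypothesis on `O`.
      by_cases cO : c.1 ∈ O ∨ c.2 ∈ O
      · have hc' : c.1 ∈ A ∪ B ∪ O ∨ c.2 ∈ A ∪ B ∪ O := by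
          simp only [Finset.mem_union]; clear * - cO; tauto
        have e : insert c.1 (insert c.2 (A ∪ B ∪ O)) = A ∪ B ∪ insert c.1 (insert c.2 O) := by
          ext v; simp only [Finset.mem_union, Finset.mem_insert]; tauto
        rw [relCount_cons_of_mem hc', e, relCount_cons_of_mem cO] at hABO
        refine ih (O := insert c.1 (insert c.2 O)) hDA hDB hAB ?_ hA hB (by omega)
        intro v hv hv'
        rw [Finset.mem_insert, Finset.mem_insert] at hv
        rcases hv with rfl | rfl | hv
        · exact absurd (Or.inl hv') hc
        · exact absurd (Or.inr hv') hc
        · exact hO v hv hv'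
      · have hc' : ¬ (c.1 ∈ A ∪ B ∪ O ∨ c.2 ∈ A ∪ B ∪ O) := by
          simp only [Finset.mem_union] at hc ⊢; clear * - cO hc; tauto
        rw [relCount_cons_of_not_mem hc', relCount_cons_of_not_mem cO] at hABO
        exact ih hDA hDB hAB hO hA hB hABO

/-! ### Arithmetic of the fresh members -/

/-- The lower bounds on the number `f` of persons of a cluster without earlier calls, in terms of
the number `w` of earlier calls that influence it and the number `τ` of their participants. -/
structure TreeBound (k f w τ : ℕ) : Prop where
  general : 2 ^ (k - 1) ≤ (f + 2) * 2 ^ w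
  of_le_succ : τ ≤ w + 1 → 2 ^ (k - 1) ≤ (f + 1) * 2 ^ w
  of_le : τ ≤ w → w + 1 ≤ k → 2 ^ (k - 1) ≤ f * 2 ^ w

theorem TreeBound.of_large {k f w τ : ℕ} (hw : k ≤ w + 1) (h : k ≤ f + τ) :
    TreeBound k f w τ := by
  have h1 : 2 ^ (k - 1) ≤ 2 ^ w := Nat.pow_le_pow_right (by norm_num) (by omega)
  have h2 : ∀ m, 1 ≤ m → 2 ^ (k - 1) ≤ m * 2 ^ w := fun m hm =>
    h1.trans (Nat.le_mul_of_pos_left _ hm)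
  exact ⟨h2 _ (by omega), fun _ => h2 _ (by omega), fun _ _ => h2 _ (by omega)⟩

/-- Here `φ` counts the participants of the joining call that are fresh for the union. Removing that
call from the earlier ones lowers `w + 1` to `w`, and the two halves of the bound add up. In the
tight case the participant count `τ + φ ≤ w + 2` puts both parts in a sharper case of the bound, and
whenever this is not sharp enough, `φ` covers the deficit. -/
theorem TreeBound.merge {k w τ φ f₁ w₁ τ₁ f₂ w₂ τ₂ : ℕ} (h₁ : TreeBound k f₁ w₁ τ₁)
    (h₂ : TreeBound k f₂ w₂ τ₂) (hw₁ : w₁ ≤ w + 1) (hw₂ : w₂ ≤ w + 1) (hφ : φ ≤ 2)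
    (hk₁ : k ≤ f₁ + φ + τ) (hk₂ : k ≤ f₂ + φ + τ)
    (h : w₁ = w + 1 → w₂ = w + 1 → τ₁ = τ + φ ∧ τ₂ = τ + φ ∧ τ + φ ≤ w + 2) :
    TreeBound k (f₁ + f₂ + φ) w τ := by
  rcases le_or_gt k (w + 1) with hk | hk
  · exact .of_large hk (by omega)
  obtain ⟨d, rfl⟩ : ∃ d, k = w + d + 2 := ⟨k - w - 2, by omega⟩
  have e0 : 2 ^ (w + d + 2 - 1) = (2 * 2 ^ d) * 2 ^ w := by
    rw [show w + d + 2 - 1 = d + 1 + w by omega, pow_add, pow_succ]; ring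
  have hpos : 0 < 2 ^ w := by positivity
  have cancel : ∀ m, 2 ^ (w + d + 2 - 1) ≤ m * 2 ^ w ↔ 2 * 2 ^ d ≤ m := fun m => by
    rw [e0]; exact Nat.mul_le_mul_right_iff hpos
  have cancel' : ∀ m w', w' ≤ w + 1 → 2 ^ (w + d + 2 - 1) ≤ m * 2 ^ w' → 2 ^ d ≤ m := by
    intro m w' hw' hm
    have : m * 2 ^ w' ≤ (2 * m) * 2 ^ w := by
      rw [show (2 * m) * 2 ^ w = m * 2 ^ (w + 1) by ring]
      exact Nat.mul_le_mul_left _ (Nat.pow_le_pow_right (by norm_num) hw')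
    have := (cancel _).1 (hm.trans this)
    omega
  have cancel'' : ∀ m w', w' ≤ w → 2 ^ (w + d + 2 - 1) ≤ m * 2 ^ w' → 2 * 2 ^ d ≤ m := by
    intro m w' hw' hm
    exact (cancel _).1 (hm.trans (Nat.mul_le_mul_left _ (Nat.pow_le_pow_right (by norm_num) hw')))
  -- From `2 ^ d = 4` on, the exponential bounds absorb a deficit of two; the two smaller values
  -- need `hk₁` and `hk₂`.
  have hd : d = 0 ∧ 2 ^ d = 1 ∨ d = 1 ∧ 2 ^ d = 2 ∨ 4 ≤ 2 ^ d := by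
    rcases d with _ | _ | d
    · simp
    · simp
    · refine Or.inr (Or.inr ?_)
      calc 4 = 2 ^ 2 := rfl
        _ ≤ 2 ^ (d + 1 + 1) := Nat.pow_le_pow_right (by norm_num) (by omega)
  have a₁ := cancel' _ _ hw₁ h₁.general
  have a₂ := cancel' _ _ hw₂ h₂.general
  by_cases hboth : w₁ = w + 1 ∧ w₂ = w + 1
  · obtain ⟨t₁, t₂, ht⟩ := h hboth.1 hboth.2
    have b₁ := cancel' _ _ hw₁ (h₁.of_le_succ (by omega))
    have b₂ := cancel' _ _ hw₂ (h₂.of_le_succ (by omega))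
    have c₁ : τ + φ ≤ w + 1 → 2 ^ d ≤ f₁ := fun hh =>
      cancel' _ _ hw₁ (h₁.of_le (by omega) (by omega))
    have c₂ : τ + φ ≤ w + 1 → 2 ^ d ≤ f₂ := fun hh =>
      cancel' _ _ hw₂ (h₂.of_le (by omega) (by omega))
    refine ⟨(cancel _).2 (by omega), fun hτ => (cancel _).2 ?_, fun hτ _ => (cancel _).2 ?_⟩
    · by_cases hh : τ + φ ≤ w + 1
      · have := c₁ hh
        have := c₂ hh
        omega
      · omega
    · by_cases hh : τ + φ ≤ w + 1
      · have := c₁ hh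
        have := c₂ hh
        omega
      · omega
  -- A part influenced by at most `w` calls already satisfies the bound of the union up to two.
  · have b : 2 * 2 ^ d ≤ f₁ + 2 ∨ 2 * 2 ^ d ≤ f₂ + 2 := by
      rcases Nat.lt_or_ge w w₁ with hlt | hge
      · exact Or.inr (cancel'' _ _ (by omega) h₂.general)
      · exact Or.inl (cancel'' _ _ hge h₁.general)
    clear cancel' cancel'' e0 h₁ h₂ h
    refine ⟨(cancel _).2 ?_, fun hτ => (cancel _).2 ?_, fun hτ _ => (cancel _).2 ?_⟩ <;>
      clear cancel <;> omega

/-! ### Minimal sets and the bound for their clusters -/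

theorem card_reach_eq (l : List (V × V)) (X : Finset V) :
    (reach l X).card = (X \ relPersons l X).card + (relPersons l X).card := by
  rw [reach_eq_union, ← Finset.card_sdiff_add_card]

theorem singleton_reach_subset {F l : List (V × V)} {C : Finset V} {v : V} (h : ClosedUnder F C)
    (hv : v ∈ C) : reach (F ++ l) {v} ⊆ reach l C := by
  rw [reach_append]
  refine reach_mono l ?_
  conv_rhs => rw [← h.reach_eq]
  exact reach_mono F (by simpa using hv)

/-- `L` is a minimal set of persons that know `k` gossips each and that are influenced by fewer than
`L.card + j` calls. -/
structure Critical (r : List (V × V)) (k j : ℕ) (L : Finset V) : Prop where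
  le_card_reach : ∀ v ∈ L, k ≤ (reach r {v}).card
  relCount_lt : relCount r L + 1 ≤ L.card + j
  le_relCount : ∀ L' ⊆ L, L'.Nonempty → L' ≠ L → L'.card + j ≤ relCount r L'

/-- The witness is what the calls of `F` trace from `L \ C`. If some call of `l` influenced `L` only
through `C`, removing `C` would lose it besides the `C.card - 1` tree calls, and `L \ C` would
contradict minimality. -/
theorem Critical.exists_exterior {F l : List (V × V)} {k j : ℕ} {L C : Finset V}
    (hL : Critical (F ++ l) k j L) (hC : Cluster F C) (hCL : C ⊆ L) (hne : C ≠ L) :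
    ∃ O, Disjoint O C ∧ relCount l (C ∪ O) ≤ relCount l O := by
  have hd : Disjoint (L \ C) C := Finset.sdiff_disjoint
  refine ⟨reach F (L \ C), hC.closedUnder.disjoint_reach hd, ?_⟩
  have hne' : (L \ C).Nonempty := by
    rw [Finset.sdiff_nonempty]
    exact fun h => hne (Finset.Subset.antisymm hCL h)
  have hne'' : L \ C ≠ L := by
    intro h
    rw [h] at hd
    obtain ⟨v, hv⟩ := hC.nonempty
    exact Finset.disjoint_left.1 hd (hCL hv) hv
  have h1 := hL.le_relCount (L \ C) Finset.sdiff_subset hne' hne''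
  have h2 := hL.relCount_lt
  have h3 : L = (L \ C) ∪ C := (Finset.sdiff_union_of_subset hCL).symm
  rw [relCount_append] at h1
  have h4 : relCount (F ++ l) L = relCount F (L \ C) + relCount F C +
      relCount l (C ∪ reach F (L \ C)) := by
    conv_lhs => rw [h3]
    rw [relCount_append, hC.closedUnder.relCount_union hd, reach_union, hC.closedUnder.reach_eq,
      Finset.union_comm C]
  have h5 := hC.relCount_add_one
  have h6 := Finset.card_sdiff_add_card_eq_card hCL
  omega

theorem mem_sdiff_relPersons {l : List (V × V)} {X : Finset V} {v : V} :
    v ∈ X \ relPersons l X ↔ v ∈ X ∧ ¬ Involved l v := by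
  rw [Finset.mem_sdiff]
  exact and_congr_right fun hv => not_congr (mem_relPersons_iff hv)

/-- The joining call is an earlier call for `A` and `B` but not for `A ∪ B`; only its participants
can become fresh. -/
theorem card_sdiff_relPersons_union {c : V × V} {l : List (V × V)} {A B : Finset V}
    (hAB : Disjoint A B) (h1 : c.1 ∈ A) (h2 : c.2 ∈ B) :
    ((A ∪ B) \ relPersons l (A ∪ B)).card = (A \ relPersons (c :: l) A).card +
      (B \ relPersons (c :: l) B).card + (({c.1, c.2} : Finset V) \ relPersons l (A ∪ B)).card := by
  have hd : ∀ v, v ∈ A → v ∉ B := fun v hv => Finset.disjoint_left.1 hAB hv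
  have hpair : ∀ v, v ∈ ({c.1, c.2} : Finset V) \ relPersons l (A ∪ B) ↔
      (v = c.1 ∨ v = c.2) ∧ ¬ Involved l v := by
    intro v
    rw [Finset.mem_sdiff, Finset.mem_insert, Finset.mem_singleton]
    refine and_congr_right fun hv => not_congr (mem_relPersons_iff ?_)
    rcases hv with rfl | rfl <;> simp [h1, h2]
  rw [← Finset.card_union_of_disjoint, ← Finset.card_union_of_disjoint]
  · congr 1
    ext v
    rw [Finset.mem_union, Finset.mem_union, hpair]
    simp only [mem_sdiff_relPersons, involved_cons, Finset.mem_union]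
    constructor
    · rintro ⟨hv | hv, hv'⟩ <;> by_cases hc : v = c.1 ∨ v = c.2 <;> simp [hv, hv', hc]
    · rintro ((⟨hv, hv'⟩ | ⟨hv, hv'⟩) | ⟨hv, hv'⟩)
      · exact ⟨Or.inl hv, fun h => hv' (Or.inr h)⟩
      · exact ⟨Or.inr hv, fun h => hv' (Or.inr h)⟩
      · exact ⟨by rcases hv with rfl | rfl <;> simp [h1, h2], hv'⟩
  · rw [Finset.disjoint_left]
    intro v hv hv'
    rw [hpair] at hv'
    rw [Finset.mem_union, mem_sdiff_relPersons, mem_sdiff_relPersons, involved_cons] at hv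
    rcases hv with hv | hv
    · exact hv.2 (Or.inl hv'.1)
    · exact hv.2 (Or.inl hv'.1)
  · exact hAB.mono Finset.sdiff_subset Finset.sdiff_subset

theorem reach_cons_subset {c : V × V} {l : List (V × V)} {A C : Finset V} (hAC : A ⊆ C)
    (h1 : c.1 ∈ C) (h2 : c.2 ∈ C) : reach (c :: l) A ⊆
      (A \ relPersons (c :: l) A) ∪ (({c.1, c.2} : Finset V) \ relPersons l C) ∪
        relPersons l C := by
  intro v hv
  have hC : v ∈ reach l C := by
    simp only [reach] at hv
    split_ifs at hv
    · exact reach_mono l (Finset.insert_subset h1 (Finset.insert_subset h2 hAC)) hv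
    · exact reach_mono l hAC hv
  by_cases hQ : v ∈ relPersons l C
  · exact Finset.mem_union_right _ hQ
  refine Finset.mem_union_left _ ?_
  have hvC : v ∈ C := by
    rw [reach_eq_union, Finset.mem_union] at hC
    exact hC.resolve_right hQ
  have hl : ¬ Involved l v := fun h => hQ ((mem_relPersons_iff hvC).2 h)
  by_cases hc : v = c.1 ∨ v = c.2
  · refine Finset.mem_union_right _ (Finset.mem_sdiff.2 ⟨?_, hQ⟩)
    simpa using hc
  · have hi : ¬ Involved (c :: l) v := by rw [involved_cons]; tauto
    rw [reach_eq_union, Finset.mem_union] at hv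
    exact Finset.mem_union_left _ (mem_sdiff_relPersons.2
      ⟨hv.resolve_right fun h => hi (involved_of_mem_relPersons h), hi⟩)

theorem card_reach_cons_le {c : V × V} {l : List (V × V)} {A C : Finset V} (hAC : A ⊆ C)
    (h1 : c.1 ∈ C) (h2 : c.2 ∈ C) : (reach (c :: l) A).card ≤
      (A \ relPersons (c :: l) A).card + (({c.1, c.2} : Finset V) \ relPersons l C).card +
        (relPersons l C).card :=
  (Finset.card_le_card (reach_cons_subset hAC h1 h2)).trans
    ((Finset.card_union_le _ _).trans (Nat.add_le_add_right (Finset.card_union_le _ _) _))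

theorem card_relPersons_cons {c : V × V} {l : List (V × V)} {A C : Finset V}
    (hA : c.1 ∈ A ∨ c.2 ∈ A) (hAC : insert c.1 (insert c.2 A) ⊆ C)
    (hN : relCount l C ≤ relCount l (insert c.1 (insert c.2 A))) :
    (relPersons (c :: l) A).card =
      (relPersons l C).card + (({c.1, c.2} : Finset V) \ relPersons l C).card := by
  simp only [relPersons, if_pos hA]
  rw [relPersons_congr l hAC hN, add_comm, Finset.card_sdiff_add_card]
  congr 1
  ext v
  simp only [Finset.mem_insert, Finset.mem_union, Finset.mem_singleton]
  tauto

/-- Induction on the cluster. One person needs `k - 1` influencing calls to know `k` gossips, so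
singletons fall under `TreeBound.of_large`; a joining call is handled by `TreeBound.merge`. -/
theorem Critical.treeBound {r : List (V × V)} {k j : ℕ} {L : Finset V} (hL : Critical r k j L)
    {F : List (V × V)} {C : Finset V} (hC : Cluster F C) {l : List (V × V)} (hr : r = F ++ l)
    (hCL : C ⊆ L) (hne : C ≠ L) :
    TreeBound k (C \ relPersons l C).card (relCount l C) (relPersons l C).card := by
  induction hC generalizing l with
  | single v =>
    obtain rfl : r = l := hr
    have h1 := hL.le_card_reach v (hCL (by simp))
    have h2 := card_reach_le r {v}
    rw [Finset.card_singleton] at h2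
    have h3 := card_reach_eq r {v}
    exact .of_large (by omega) (by omega)
  | @skip F C c hC h1 h2 ih =>
    have := @ih (c :: l) (by simpa using hr) hCL hne
    simpa only [relPersons, relCount, h1, h2, or_self, if_false] using this
  | @merge F A B c hA hB hAB h1 h2 ihA ihB =>
    have hr' : r = F ++ (c :: l) := by simpa using hr
    have hAC : A ⊆ A ∪ B := Finset.subset_union_left
    have hBC : B ⊆ A ∪ B := Finset.subset_union_right
    have hd : ∀ v, v ∈ A → v ∉ B := fun v hv => Finset.disjoint_left.1 hAB hv
    have hAL : A ≠ L := fun h => hd _ (h ▸ hCL (hBC h2)) h2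
    have hBL : B ≠ L := fun h => hd _ h1 (h ▸ hCL (hAC h1))
    have iA := ihA hr' (hAC.trans hCL) hAL
    have iB := ihB hr' (hBC.trans hCL) hBL
    have sA : insert c.1 (insert c.2 A) ⊆ A ∪ B :=
      Finset.insert_subset (hAC h1) (Finset.insert_subset (hBC h2) hAC)
    have sB : insert c.1 (insert c.2 B) ⊆ A ∪ B :=
      Finset.insert_subset (hAC h1) (Finset.insert_subset (hBC h2) hBC)
    have wA := relCount_cons_of_mem (l := l) (Or.inl h1 : c.1 ∈ A ∨ c.2 ∈ A)
    have wB := relCount_cons_of_mem (l := l) (Or.inr h2 : c.1 ∈ B ∨ c.2 ∈ B)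
    have mA := relCount_mono l sA
    have mB := relCount_mono l sB
    rw [card_sdiff_relPersons_union hAB h1 h2]
    refine iA.merge iB (by omega) (by omega) ?_ ?_ ?_ ?_
    · exact (Finset.card_le_card Finset.sdiff_subset).trans Finset.card_le_two
    · refine (hL.le_card_reach c.1 (hCL (hAC h1))).trans (le_trans (Finset.card_le_card ?_)
        (card_reach_cons_le hAC (hAC h1) (hBC h2)))
      rw [hr']
      exact singleton_reach_subset hA.closedUnder h1
    · refine (hL.le_card_reach c.2 (hCL (hBC h2))).trans (le_trans (Finset.card_le_card ?_)
        (card_reach_cons_le hBC (hAC h1) (hBC h2)))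
      rw [hr']
      exact singleton_reach_subset hB.closedUnder h2
    · intro e1 e2
      have tA := card_relPersons_cons (l := l) (Or.inl h1) sA (by omega)
      have tB := card_relPersons_cons (l := l) (Or.inr h2) sB (by omega)
      refine ⟨tA, tB, ?_⟩
      subst hr
      -- All calls that influence `A ∪ B` influence both parts joined with the call's participants,
      -- and also the exterior `O`. Hence they all influence the pair of participants itself, whose
      -- trace has at most `2 + w` persons.
      obtain ⟨O, hO, hON⟩ := hL.exists_exterior (hA.merge hB hAB h1 h2) hCL hne
      have eU : insert c.1 (insert c.2 A) ∪ insert c.1 (insert c.2 B) = A ∪ B :=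
        Finset.Subset.antisymm (Finset.union_subset sA sB)
          (Finset.union_subset_union (fun v hv => by simp [hv]) (fun v hv => by simp [hv]))
      have hZ := relCount_le_of_inter l (A := insert c.1 (insert c.2 A))
        (B := insert c.1 (insert c.2 B)) (D := {c.1, c.2}) (O := O)
        (fun v hv => by
          simp only [Finset.mem_insert, Finset.mem_singleton] at hv ⊢; tauto)
        (fun v hv => by
          simp only [Finset.mem_insert, Finset.mem_singleton] at hv ⊢; tauto)
        (fun v hv hv' => by
          have := hd v
          clear * - this hv hv'
          simp only [Finset.mem_insert, Finset.mem_singleton] at hv hv' ⊢; tauto)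
        (fun v hv hv' => absurd (eU ▸ hv') (Finset.disjoint_left.1 hO hv))
        (by rw [eU]; omega) (by rw [eU]; omega) (by rw [eU]; exact hON)
      rw [eU] at hZ
      have sD : ({c.1, c.2} : Finset V) ⊆ A ∪ B :=
        Finset.insert_subset (hAC h1) (Finset.singleton_subset_iff.2 (hBC h2))
      have h3 := card_reach_le l {c.1, c.2}
      have h4 := relCount_mono l sD
      rw [reach_eq_union, relPersons_congr l sD hZ, ← Finset.card_sdiff_add_card] at h3
      have h5 : ({c.1, c.2} : Finset V).card ≤ 2 := Finset.card_le_two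
      omega

/-! ### Splitting a minimal set into two clusters -/

/-- The calls of `F` split `L` into proper clusters, `cmp v` being the cluster of `v`. -/
structure ClusterPartition (F : List (V × V)) (L : Finset V) (cmp : V → Finset V) : Prop where
  cluster : ∀ v ∈ L, Cluster F (cmp v)
  self_mem : ∀ v ∈ L, v ∈ cmp v
  subset : ∀ v ∈ L, cmp v ⊆ L
  ne : ∀ v ∈ L, cmp v ≠ L
  eq_of_mem : ∀ v ∈ L, ∀ w ∈ cmp v, cmp w = cmp v

theorem ClusterPartition.closedUnder {F : List (V × V)} {L : Finset V} {cmp : V → Finset V}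
    (h : ClusterPartition F L cmp) : ClosedUnder F L := by
  intro c hc
  constructor
  · intro h1
    exact h.subset _ h1 (((h.cluster _ h1).closedUnder c hc).1 (h.self_mem _ h1))
  · intro h1
    exact h.subset _ h1 (((h.cluster _ h1).closedUnder c hc).2 (h.self_mem _ h1))

theorem ClusterPartition.skip {F : List (V × V)} {L : Finset V} {cmp : V → Finset V} {c : V × V}
    (h : ClusterPartition F L cmp) (h1 : c.1 ∉ L) (h2 : c.2 ∉ L) :
    ClusterPartition (F ++ [c]) L cmp where
  cluster v hv := (h.cluster v hv).skip (fun hc => h1 (h.subset v hv hc))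
    (fun hc => h2 (h.subset v hv hc))
  self_mem := h.self_mem
  subset := h.subset
  ne := h.ne
  eq_of_mem := h.eq_of_mem

theorem ClusterPartition.disjoint {F : List (V × V)} {L : Finset V} {cmp : V → Finset V} {v w : V}
    (h : ClusterPartition F L cmp) (hv : v ∈ L) (hw : w ∈ L) (hne : cmp v ≠ cmp w) :
    Disjoint (cmp v) (cmp w) := by
  rw [Finset.disjoint_left]
  intro u hu hu'
  exact hne ((h.eq_of_mem v hv u hu).symm.trans (h.eq_of_mem w hw u hu'))

theorem ClusterPartition.merge {F : List (V × V)} {L : Finset V} {cmp : V → Finset V} {c : V × V}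
    (h : ClusterPartition F L cmp) (h1 : c.1 ∈ L) (h2 : c.2 ∈ L) (hne : cmp c.1 ≠ cmp c.2)
    (hL : cmp c.1 ∪ cmp c.2 ≠ L) :
    ClusterPartition (F ++ [c]) L
      (fun v => if v ∈ cmp c.1 ∪ cmp c.2 then cmp c.1 ∪ cmp c.2 else cmp v) where
  cluster v hv := by
    split_ifs with hc
    · exact (h.cluster _ h1).merge (h.cluster _ h2) (h.disjoint h1 h2 hne) (h.self_mem _ h1)
        (h.self_mem _ h2)
    · rw [Finset.mem_union, not_or] at hc
      refine (h.cluster v hv).skip (fun hm => hc.1 ?_) (fun hm => hc.2 ?_)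
      · rw [h.eq_of_mem v hv _ hm]; exact h.self_mem v hv
      · rw [h.eq_of_mem v hv _ hm]; exact h.self_mem v hv
  self_mem v hv := by
    split_ifs with hc
    · exact hc
    · exact h.self_mem v hv
  subset v hv := by
    split_ifs with hc
    · exact Finset.union_subset (h.subset _ h1) (h.subset _ h2)
    · exact h.subset v hv
  ne v hv := by
    split_ifs with hc
    · exact hL
    · exact h.ne v hv
  eq_of_mem v hv w hw := by
    split_ifs at hw with hc
    · rw [if_pos hw, if_pos hc]
    · have hw' := h.eq_of_mem v hv w hw
      have hcw : w ∉ cmp c.1 ∪ cmp c.2 := by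
        rw [Finset.mem_union, not_or] at hc ⊢
        constructor
        · intro hm
          apply hc.1
          rw [← h.eq_of_mem _ h1 w hm, hw']
          exact h.self_mem v hv
        · intro hm
          apply hc.2
          rw [← h.eq_of_mem _ h2 w hm, hw']
          exact h.self_mem v hv
      rw [if_neg hc, if_neg hcw, hw']

/-- Otherwise discarding `C` saves this call and the `C.card - 1` tree calls, so `L \ C` violates
minimality. -/
theorem Critical.mem_sdiff_of_call {F l : List (V × V)} {c : V × V} {k j : ℕ} {L C : Finset V}
    (hL : Critical (F ++ c :: l) k j L) (hF : ClosedUnder F L) (hC : Cluster F C) (hCL : C ⊆ L)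
    (hne : C ≠ L) (hc : c.1 ∈ C ∨ c.2 ∈ C) : c.1 ∈ L \ C ∨ c.2 ∈ L \ C := by
  by_contra hX
  have hd : Disjoint (L \ C) C := Finset.sdiff_disjoint
  have hXF : ClosedUnder F (L \ C) := by
    intro d hd
    rw [Finset.mem_sdiff, Finset.mem_sdiff, hF d hd, hC.closedUnder d hd]
  have hne' : (L \ C).Nonempty := by
    rw [Finset.sdiff_nonempty]
    exact fun h => hne (Finset.Subset.antisymm hCL h)
  have hne'' : L \ C ≠ L := by
    intro h
    rw [h] at hd
    obtain ⟨v, hv⟩ := hC.nonempty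
    exact Finset.disjoint_left.1 hd (hCL hv) hv
  have h1 := hL.le_relCount (L \ C) Finset.sdiff_subset hne' hne''
  have h2 := hL.relCount_lt
  have h3 : relCount F L = relCount F (L \ C) + relCount F C := by
    conv_lhs => rw [← Finset.sdiff_union_of_subset hCL]
    exact hC.closedUnder.relCount_union hd
  rw [relCount_append, hXF.reach_eq, relCount_cons_of_not_mem hX] at h1
  rw [relCount_append, hF.reach_eq, h3,
    relCount_cons_of_mem (hc.imp (fun h => hCL h) (fun h => hCL h))] at h2
  have h4 : relCount l (L \ C) ≤ relCount l (insert c.1 (insert c.2 L)) :=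
    relCount_mono l (Finset.sdiff_subset.trans fun v hv => by simp [hv])
  have h5 := hC.relCount_add_one
  have h6 := Finset.card_sdiff_add_card_eq_card hCL
  omega

/-- Going back in time, a call touching `L` always joins two different clusters. If no union were
ever all of `L`, the partition into proper clusters would survive to the very beginning. -/
theorem Critical.exists_two_clusters {r : List (V × V)} {k j : ℕ} {L : Finset V}
    (hL : Critical r k j L) (hjk : j + 2 ≤ k) (hne : L.Nonempty) :
    ∃ F l A B, r = F ++ l ∧ Cluster F A ∧ Cluster F B ∧ Disjoint A B ∧ A ∪ B = L := by
  by_contra hno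
  have main : ∀ F l, r = F ++ l → ∃ cmp, ClusterPartition F L cmp := by
    intro F
    induction F using List.reverseRecOn with
    | nil =>
      intro l hr
      refine ⟨fun v => {v}, fun v _ => .single v, fun v _ => by simp, fun v hv => by simpa using hv,
        fun v hv h => ?_, fun v _ w hw => by rw [Finset.mem_singleton.1 hw]⟩
      -- If `L` were `{v}`, at most `j` calls would influence `v`, who would then know at most `j +
      -- 1 < k` gossips.
      have h1 := hL.le_card_reach v hv
      have h2 := hL.relCount_lt
      have h3 := card_reach_le r {v}
      rw [← h] at h2
      rw [Finset.card_singleton] at h2 h3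
      omega
    | append_singleton F c ih =>
      intro l hr
      have hr' : r = F ++ (c :: l) := by simpa using hr
      obtain ⟨cmp, h⟩ := ih _ hr'
      have hL' := hL
      rw [hr'] at hL'
      have hout : ∀ x ∈ L, c.1 ∈ cmp x ∨ c.2 ∈ cmp x → c.1 ∈ L \ cmp x ∨ c.2 ∈ L \ cmp x :=
        fun x hx => hL'.mem_sdiff_of_call h.closedUnder (h.cluster x hx) (h.subset x hx) (h.ne x hx)
      by_cases h1 : c.1 ∈ L
      · have o := hout _ h1 (Or.inl (h.self_mem _ h1))
        simp only [Finset.mem_sdiff, h.self_mem _ h1, not_true, and_false, false_or] at o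
        have hne : cmp c.1 ≠ cmp c.2 := fun e => o.2 (e ▸ h.self_mem _ o.1)
        refine ⟨_, h.merge h1 o.1 hne fun e => hno ?_⟩
        exact ⟨F, c :: l, _, _, hr', h.cluster _ h1, h.cluster _ o.1, h.disjoint h1 o.1 hne, e⟩
      · by_cases h2 : c.2 ∈ L
        · have o := hout _ h2 (Or.inr (h.self_mem _ h2))
          simp only [Finset.mem_sdiff, h.self_mem _ h2, not_true, and_false, h1, false_and,
            or_self] at o
        · exact ⟨cmp, h.skip h1 h2⟩
  obtain ⟨cmp, h⟩ := main r [] (by simp)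
  obtain ⟨v, hv⟩ := hne
  -- With no earlier calls left, a proper cluster is influenced by one call fewer than it has
  -- members, against minimality.
  have h1 := (h.cluster v hv).relCount_add_one
  have h2 := hL.le_relCount _ (h.subset v hv) (h.cluster v hv).nonempty (h.ne v hv)
  omega

/-! ### The lower bound -/

theorem lower_bound_aux {r : List (V × V)} {k : ℕ} (m : ℕ) {L : Finset V} (hm : L.card ≤ m)
    (hne : L.Nonempty) (hK : ∀ v ∈ L, k ≤ (reach r {v}).card) {j : ℕ}
    (hN : relCount r L + 1 ≤ L.card + j) (hj : j + 3 ≤ k) :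
    j + 2 ^ (k - j - 1) ≤ (reach r L).card + 1 := by
  induction m generalizing L j with
  | zero => exact absurd (Finset.card_pos.2 hne) (by omega)
  | succ m ih =>
    rcases Nat.eq_or_lt_of_le hj with hj | hj
    -- For `k = j + 3` the claim only says that `k` gossips reach `L`, and one member suffices.
    · obtain ⟨v, hv⟩ := hne
      have h1 := (hK v hv).trans (Finset.card_le_card (reach_mono r (by simpa using hv)))
      rw [show k - j - 1 = 2 by omega]
      omega
    by_contra hlt
    have hL : Critical r k j L := by
      refine ⟨hK, hN, fun L' hs hne' hL' => ?_⟩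
      by_contra hlt'
      have hcard := Finset.card_lt_card (Finset.ssubset_iff_subset_ne.2 ⟨hs, hL'⟩)
      have h1 := ih (by omega) hne' (fun v hv => hK v (hs hv)) (by omega) (by omega : j + 3 ≤ k)
      have h2 := Finset.card_le_card (reach_mono r hs)
      omega
    obtain ⟨F, l, A, B, rfl, hA, hB, hAB, rfl⟩ := hL.exists_two_clusters (by omega) hne
    have hd : ∀ v, v ∈ A → v ∉ B := fun v hv => Finset.disjoint_left.1 hAB hv
    have hAC : A ⊆ A ∪ B := Finset.subset_union_left
    have hBC : B ⊆ A ∪ B := Finset.subset_union_right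
    have hAL : A ≠ A ∪ B := fun h => by
      obtain ⟨v, hv⟩ := hB.nonempty
      exact hd v (h ▸ hBC hv) hv
    have hBL : B ≠ A ∪ B := fun h => by
      obtain ⟨v, hv⟩ := hA.nonempty
      exact hd v hv (h ▸ hAC hv)
    have a1 := hL.le_relCount A hAC hA.nonempty hAL
    have b1 := hL.le_relCount B hBC hB.nonempty hBL
    have a2 := hA.relCount_add_one
    have b2 := hB.relCount_add_one
    have hcard := Finset.card_union_of_disjoint hAB
    have hBlt := Finset.card_lt_card (Finset.ssubset_iff_subset_ne.2 ⟨hBC, hBL⟩)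
    have hcount := hN
    rw [relCount_append, hA.closedUnder.reach_eq] at a1
    rw [relCount_append, hB.closedUnder.relCount_union hAB, reach_union, hA.closedUnder.reach_eq,
      hB.closedUnder.reach_eq] at hcount
    -- At most `j + 1` calls of `l` influence `L`, hence `B`; with its `B.card - 1` tree calls, `B`
    -- meets the hypothesis for `j + 1`.
    have iB := ih (j := j + 1) (by omega) hB.nonempty (fun v hv => hK v (hBC hv))
      (by
        have := relCount_mono l hBC
        rw [relCount_append, hB.closedUnder.reach_eq]
        omega) (by omega)
    rw [relCount_append, hB.closedUnder.reach_eq] at b1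
    have a3 := relCount_mono l hAC
    have b3 := relCount_mono l hBC
    have wA : relCount l A = j + 1 := by omega
    have wB : relCount l B = j + 1 := by omega
    have qA := relPersons_congr l hAC (by omega)
    have qB := relPersons_congr l hBC (by omega)
    have tA := hL.treeBound hA rfl hAC hAL
    have tB := hL.treeBound hB rfl hBC hBL
    rw [wA, qA] at tA
    rw [wB, qB] at tB
    rw [reach_append, hB.closedUnder.reach_eq, card_reach_eq, qB] at iB
    rw [reach_append, reach_union, hA.closedUnder.reach_eq, hB.closedUnder.reach_eq, card_reach_eq,
      Finset.union_sdiff_distrib, Finset.card_union_of_disjoint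
        (hAB.mono Finset.sdiff_subset Finset.sdiff_subset)] at hlt
    obtain ⟨d, rfl⟩ : ∃ d, k = j + d + 2 := ⟨k - j - 2, by omega⟩
    have e0 : 2 ^ (j + d + 2 - 1) = 2 ^ d * 2 ^ (j + 1) := by
      rw [← pow_add]; congr 1; omega
    have cancel : ∀ x, 2 ^ (j + d + 2 - 1) ≤ x * 2 ^ (j + 1) → 2 ^ d ≤ x := fun x hx => by
      rw [e0] at hx
      exact Nat.le_of_mul_le_mul_right hx (by positivity)
    have cA := cancel _ tA.general
    have cB := cancel _ tB.general
    rw [show j + d + 2 - (j + 1) - 1 = d by omega] at iB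
    rw [show j + d + 2 - j - 1 = d + 1 by omega, pow_succ] at hlt
    -- With few participants, `A` has at least `2 ^ d - 1` fresh members, to be added to the bound
    -- `iB`. Otherwise there are at least `j + 3` participants, which outweighs the loss of two in
    -- both `cA` and `cB`.
    by_cases hτ : (relPersons l (A ∪ B)).card ≤ j + 1 + 1
    · have cA' := cancel _ (tA.of_le_succ hτ)
      omega
    · omega

theorem lower_bound [Fintype V] {s : List (V × V)} {k j : ℕ} (hs : IsInforming k s)
    (hV : 0 < Fintype.card V) (hj : j + 3 ≤ k) (hlen : s.length + 1 ≤ Fintype.card V + j) :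
    j + 2 ^ (k - j - 1) ≤ Fintype.card V + 1 := by
  have hc := relCount_le_length s.reverse Finset.univ
  rw [List.length_reverse] at hc
  have h := lower_bound_aux (r := s.reverse) (k := k) (L := Finset.univ) _ le_rfl
    (Finset.card_pos.1 hV) (fun v _ => by rw [← knowledge_eq_reach]; exact hs v)
    (by rw [Finset.card_univ]; omega) hj
  exact h.trans (Nat.succ_le_succ (Finset.card_le_univ _))

end PartialGossip

namespace PartialGossip

/-! ### Constructions for the upper bound -/

theorem subset_call {V : Type*} [DecidableEq V] (K : V → Finset V) (c : V × V) (v : V) :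
    K v ⊆ call K c v := by
  unfold call
  split_ifs with h
  · rcases h with rfl | rfl
    · exact Finset.subset_union_left
    · exact Finset.subset_union_right
  · exact Finset.Subset.refl _

theorem subset_foldl_call {V : Type*} [DecidableEq V] (s : List (V × V)) (K : V → Finset V)
    (v : V) : K v ⊆ s.foldl call K v := by
  induction s generalizing K with
  | nil => exact Finset.Subset.refl _
  | cons c s ih => exact (subset_call K c v).trans (ih _)

theorem union_subset_foldl_call {V : Type*} [DecidableEq V] {s : List (V × V)} {c : V × V}
    (hc : c ∈ s) (K : V → Finset V) {v : V} (hv : v = c.1 ∨ v = c.2) :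
    K c.1 ∪ K c.2 ⊆ s.foldl call K v := by
  induction s generalizing K with
  | nil => simp at hc
  | cons d s ih =>
    rw [List.foldl_cons]
    rcases List.mem_cons.1 hc with rfl | hc
    · refine Finset.Subset.trans ?_ (subset_foldl_call s _ v)
      simp only [call, if_pos hv, Finset.Subset.refl]
    · exact (Finset.union_subset_union (subset_call K d _) (subset_call K d _)).trans (ih hc _)

/-- A scheme is transported along `f` while each gossip `v` stands for a bundle `g v`; bundles of
more than one gossip describe calls made beforehand. -/
theorem biUnion_subset_foldl_call {V W : Type*} [DecidableEq V] [DecidableEq W] {f : V → W}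
    (hf : Function.Injective f) (g : V → Finset W) (s : List (V × V)) {K : V → Finset V}
    {K' : W → Finset W} (h : ∀ v, (K v).biUnion g ⊆ K' (f v)) (v : V) :
    (s.foldl call K v).biUnion g ⊆ (s.map (Prod.map f f)).foldl call K' (f v) := by
  induction s generalizing K K' with
  | nil => exact h v
  | cons c s ih =>
    rw [List.map_cons, List.foldl_cons, List.foldl_cons]
    refine ih fun u => ?_
    simp only [call, Prod.map_fst, Prod.map_snd, hf.eq_iff]
    split_ifs
    · rw [Finset.union_biUnion]
      exact Finset.union_subset_union (h _) (h _)
    · exact h u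

theorem IsScheme.map {V W : Type*} {f : V → W} (hf : Function.Injective f) {s : List (V × V)}
    (hs : IsScheme s) : IsScheme (s.map (Prod.map f f)) := by
  intro c hc
  obtain ⟨d, hd, rfl⟩ := List.mem_map.1 hc
  exact fun h => hs d hd (hf h)

/-- Some `m` calls among `n` persons give every person at least `k` gossips, and some gossip becomes
known to everybody. -/
def Achieves (n m k : ℕ) : Prop :=
  ∃ (V : Type) (_ : Fintype V) (_ : DecidableEq V) (s : List (V × V)) (z : V),
    Fintype.card V = n ∧ IsScheme s ∧ s.length = m ∧
      ∀ v, z ∈ knowledge s v ∧ k ≤ (knowledge s v).card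

theorem achieves_four : Achieves 4 4 4 := by
  refine ⟨Fin 4, inferInstance, inferInstance, [(0, 1), (2, 3), (0, 2), (1, 3)], 0, by simp,
    ?_, rfl, ?_⟩
  · unfold IsScheme; decide
  · decide

theorem Achieves.exists_isInforming {n m k : ℕ} (h : Achieves n m k) :
    ∃ s : List (Fin n × Fin n), IsScheme s ∧ IsInforming k s ∧ s.length = m := by
  obtain ⟨V, _, _, s, z, hn, hs, hm, hk⟩ := h
  have e : V ≃ Fin n := Fintype.equivFinOfCardEq hn
  refine ⟨s.map (Prod.map e e), hs.map e.injective, fun w => ?_, by simpa using hm⟩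
  obtain ⟨v, rfl⟩ := e.surjective w
  have h1 := biUnion_subset_foldl_call e.injective (fun v => {e v}) s (K := fun v => {v})
    (K' := fun v => {v}) (fun v => by simp) v
  refine (hk v).2.trans (le_trans (le_of_eq ?_) (Finset.card_le_card h1))
  rw [Finset.biUnion_singleton, Finset.card_image_of_injective _ e.injective]
  rfl

theorem card_image_some_lt {V : Type*} [DecidableEq V] {k : ℕ} {X : Finset V}
    {Y : Finset (Option V)} (hX : k ≤ X.card) (hXY : ∀ v ∈ X, some v ∈ Y) (hY : none ∈ Y) :
    k + 1 ≤ Y.card := by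
  have h1 : insert none (X.image some) ⊆ Y := by
    refine Finset.insert_subset hY fun w hw => ?_
    obtain ⟨v, hv, rfl⟩ := Finset.mem_image.1 hw
    exact hXY v hv
  have h2 := Finset.card_le_card h1
  rw [Finset.card_insert_of_notMem (by simp),
    Finset.card_image_of_injective _ (Option.some_injective V)] at h2
  omega

/-- A further person who calls at the end. -/
theorem Achieves.join {n m k : ℕ} (h : Achieves n m k) : Achieves (n + 1) (m + 1) k := by
  obtain ⟨V, _, _, s, z, hn, hs, hm, hk⟩ := h
  have hf := Option.some_injective V
  have h1 := biUnion_subset_foldl_call hf (fun v => {some v}) s (K := fun v => {v})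
    (K' := fun v => {v}) (fun v => by simp)
  set K := (s.map (Prod.map some some)).foldl call (fun v : Option V => {v})
  have h2 : ∀ v, some z ∈ K (some v) ∧ k ≤ (K (some v)).card := by
    intro v
    constructor
    · exact h1 v (Finset.mem_biUnion.2 ⟨z, (hk v).1, by simp⟩)
    · refine (hk v).2.trans (le_trans (le_of_eq ?_) (Finset.card_le_card (h1 v)))
      rw [Finset.biUnion_singleton, Finset.card_image_of_injective _ hf]
      rfl
  refine ⟨Option V, inferInstance, inferInstance, s.map (Prod.map some some) ++ [(none, some z)],
    some z, by simp [hn], ?_, by simp [hm], ?_⟩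
  · intro c hc
    rcases List.mem_append.1 hc with hc | hc
    · exact hs.map hf c hc
    · rw [List.mem_singleton.1 hc]; simp
  · intro w
    have e : knowledge (s.map (Prod.map some some) ++ [(none, some z)]) w =
        [((none : Option V), some z)].foldl call K w := by
      rw [knowledge, List.foldl_append]
    rw [e]
    rcases w with _ | v
    · have h3 := (Finset.subset_union_right (s₁ := K none)).trans
        (union_subset_foldl_call (c := (none, some z)) (List.mem_singleton_self _) K
          (Or.inl rfl))
      exact ⟨h3 (h2 z).1, (h2 z).2.trans (Finset.card_le_card h3)⟩
    · have h3 := subset_foldl_call [((none : Option V), some z)] K (some v)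
      exact ⟨h3 (h2 v).1, (h2 v).2.trans (Finset.card_le_card h3)⟩

/-- A further person who makes the first and the last call. -/
theorem Achieves.join_twice {n m k : ℕ} (h : Achieves n m k) :
    Achieves (n + 1) (m + 2) (k + 1) := by
  obtain ⟨V, _, _, s, z, hn, hs, hm, hk⟩ := h
  have hf := Option.some_injective V
  set K₀ := call (fun v : Option V => {v}) (none, some z) with hK₀
  -- After the first call the gossip of `none` travels with that of `z`, which reaches everybody, so
  -- each old person gains one gossip.
  have h1 := biUnion_subset_foldl_call hf (fun v => if v = z then {some v, none} else {some v}) s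
    (K := fun v => {v}) (K' := K₀) (fun v => by
      rw [Finset.singleton_biUnion, hK₀]
      by_cases hv : v = z
      · subst hv
        simp [call, Finset.pair_comm]
      · simp [call, hv])
  set K := (s.map (Prod.map some some)).foldl call K₀
  have h2 : ∀ v, (∀ u ∈ knowledge s v, some u ∈ K (some v)) ∧ none ∈ K (some v) := by
    intro v
    refine ⟨fun u hu => h1 v (Finset.mem_biUnion.2 ⟨u, hu, ?_⟩),
      h1 v (Finset.mem_biUnion.2 ⟨z, (hk v).1, by simp⟩)⟩
    split_ifs <;> simp
  have h4 : ∀ v, k + 1 ≤ (K (some v)).card := fun v =>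
    card_image_some_lt (hk v).2 (h2 v).1 (h2 v).2
  refine ⟨Option V, inferInstance, inferInstance,
    (none, some z) :: (s.map (Prod.map some some) ++ [(none, some z)]),
    some z, by simp [hn], ?_, by simp [hm], ?_⟩
  · intro c hc
    rcases List.mem_cons.1 hc with rfl | hc
    · simp
    rcases List.mem_append.1 hc with hc | hc
    · exact hs.map hf c hc
    · rw [List.mem_singleton.1 hc]; simp
  · intro w
    have e : knowledge ((none, some z) :: (s.map (Prod.map some some) ++ [(none, some z)])) w =
        [((none : Option V), some z)].foldl call K w := by
      rw [knowledge, List.foldl_cons, List.foldl_append]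
    rw [e]
    rcases w with _ | v
    · have h3 := (Finset.subset_union_right (s₁ := K none)).trans
        (union_subset_foldl_call (c := (none, some z)) (List.mem_singleton_self _) K
          (Or.inl rfl))
      exact ⟨h3 ((h2 z).1 z (hk z).1), (h4 z).trans (Finset.card_le_card h3)⟩
    · have h3 := subset_foldl_call [((none : Option V), some z)] K (some v)
      exact ⟨h3 ((h2 v).1 z (hk v).1), (h4 v).trans (Finset.card_le_card h3)⟩

/-- Every person finally calls a further person of his own. -/
theorem Achieves.double {n m k : ℕ} (h : Achieves n m k) : Achieves (2 * n) (m + n) (k + 1) := by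
  obtain ⟨V, _, _, s, z, hn, hs, hm, hk⟩ := h
  have hf : Function.Injective (Sum.inl : V → V ⊕ V) := Sum.inl_injective
  have h1 := biUnion_subset_foldl_call hf (fun v => {Sum.inl v}) s (K := fun v => {v})
    (K' := fun v => {v}) (fun v => by simp)
  have h0 := subset_foldl_call (s.map (Prod.map Sum.inl Sum.inl)) (fun v : V ⊕ V => {v})
  set K := (s.map (Prod.map Sum.inl Sum.inl)).foldl call (fun v : V ⊕ V => {v})
  set b : List ((V ⊕ V) × (V ⊕ V)) := Finset.univ.toList.map fun v : V => (Sum.inl v, Sum.inr v)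
    with hb
  refine ⟨V ⊕ V, inferInstance, inferInstance, s.map (Prod.map Sum.inl Sum.inl) ++ b,
    Sum.inl z, by simp [hn, two_mul], ?_, by simp [hm, hb, hn], ?_⟩
  · intro c hc
    rcases List.mem_append.1 hc with hc | hc
    · exact hs.map hf c hc
    · obtain ⟨v, -, rfl⟩ := List.mem_map.1 hc
      simp
  · have main : ∀ v w, w = Sum.inl v ∨ w = Sum.inr v →
        Sum.inl z ∈ knowledge (s.map (Prod.map Sum.inl Sum.inl) ++ b) w ∧
          k + 1 ≤ (knowledge (s.map (Prod.map Sum.inl Sum.inl) ++ b) w).card := by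
      intro v w hw
      have h2 := union_subset_foldl_call (s := b) (c := (Sum.inl v, Sum.inr v))
        (List.mem_map.2 ⟨v, by simp, rfl⟩) K hw
      have e : knowledge (s.map (Prod.map Sum.inl Sum.inl) ++ b) w = b.foldl call K w := by
        rw [knowledge, List.foldl_append]
      rw [e]
      -- The partner has made no call before, so his gossip is new to `v`.
      have h3 : insert (Sum.inr v) ((knowledge s v).image Sum.inl) ⊆ b.foldl call K w := by
        refine Finset.insert_subset (h2 (Finset.mem_union_right _ (h0 _ (by simp)))) ?_
        refine Finset.Subset.trans ?_ (Finset.subset_union_left.trans h2)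
        rw [← Finset.biUnion_singleton]
        exact h1 v
      refine ⟨h3 (by simpa using (hk v).1), ?_⟩
      have h4 := Finset.card_le_card h3
      rw [Finset.card_insert_of_notMem (by simp), Finset.card_image_of_injective _ hf] at h4
      have := (hk v).2
      omega
    rintro (v | v)
    · exact main v _ (Or.inl rfl)
    · exact main v _ (Or.inr rfl)

theorem achieves_two_pow (p : ℕ) : Achieves (2 ^ (p + 2)) (2 ^ (p + 2)) (p + 4) := by
  induction p with
  | zero => exact achieves_four
  | succ p ih =>
    have := ih.double
    rwa [← two_mul, ← pow_succ'] at this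

theorem achieves_of_le {n p i : ℕ} (h : 2 ^ (p + 2) + i ≤ n) : Achieves n (n + i) (p + 4 + i) := by
  induction n, h using Nat.le_induction with
  | base =>
    induction i with
    | zero => exact achieves_two_pow p
    | succ i ih =>
      have := ih.join_twice
      rwa [show 2 ^ (p + 2) + i + i + 2 = 2 ^ (p + 2) + (i + 1) + (i + 1) by ring] at this
  | succ n _ ih =>
    have := ih.join
    rwa [show n + i + 1 = n + 1 + i by ring] at this

end PartialGossip

/-! ### The two bounds together -/

theorem theorem1 (n k : ℕ) (i : ℕ) (hi : (i : ℤ) ≤ (k : ℤ) - 4)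
    (hlow : PartialGossip.t k (i : ℤ) ≤ (n : ℤ))
    (hupp : (n : ℤ) < PartialGossip.t k ((i : ℤ) - 1)) :
    PartialGossip.P n k = n + i := by
  obtain ⟨p, rfl⟩ : ∃ p, k = p + 4 + i := ⟨k - 4 - i, by omega⟩
  have hlow' : 2 ^ (p + 2) + i ≤ n := by
    rw [PartialGossip.t, show (((p + 4 + i : ℕ) : ℤ) - i - 2).toNat = p + 2 by omega] at hlow
    have : ((2 ^ (p + 2) + i : ℕ) : ℤ) ≤ n := by push_cast; linarith
    exact_mod_cast this
  have hupp' : n + 1 < i + 2 ^ (p + 3) := by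
    rw [PartialGossip.t,
      show (((p + 4 + i : ℕ) : ℤ) - ((i : ℤ) - 1) - 2).toNat = p + 3 by omega] at hupp
    have : ((n + 1 : ℕ) : ℤ) < ((i + 2 ^ (p + 3) : ℕ) : ℤ) := by push_cast; linarith
    exact_mod_cast this
  have hmem := (PartialGossip.achieves_of_le hlow').exists_isInforming
  refine le_antisymm (Nat.sInf_le hmem) (le_csInf ⟨_, hmem⟩ ?_)
  rintro m ⟨s, -, hs, rfl⟩
  by_contra hlt
  have hpos : 0 < 2 ^ (p + 2) := by positivity
  -- Fewer than `n + i` calls would force `n` to be at least `t k (i - 1)`.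
  have h := PartialGossip.lower_bound (j := i) hs (by rw [Fintype.card_fin]; omega) (by omega)
    (by rw [Fintype.card_fin]; omega)
  rw [Fintype.card_fin, show p + 4 + i - i - 1 = p + 3 by omega] at h
  omega
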